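/- Let $p$ be an odd prime, let $s\ge 2$, $m\ge 1$ and $\nu\ge 2$ be integers, and let $R$ be the Galois ring of characteristic $p^s$ and cardinality $p^{sm}$, that is, a finite commutative ring of this characteristic and cardinality in which the zero divisors together with $0$ form the principal ideal $(p)$. Let $z\in R^*$ be a non-square unit, let $\Delta=(1)$ or $\Delta=(z)$, and put $$S=\begin{pmatrix}0&I^{(\nu)}&0\\ I^{(\nu)}&0&0\\ 0&0&\Delta\end{pmatrix},$$ a symmetric matrix of order $2\nu+1$ over $R$. For a row vector $\alpha\in R^{2\nu+1}$ with at least one unit coordinate, let $[\alpha]$ be the class of $\alpha$ up to multiplication by units of $R$. The orthogonal graph $\Gamma^{2\nu+1}$ has as vertices the classes $[\alpha]$ with $\alpha S\alpha^t=0$, and $[\alpha]$ and $[\beta]$ are adjacent if $\alpha S\beta^t\in R^*$. An $(n,k,b,c)$-Deza graph is a $k$-regular graph on $n$ vertices in which any two distinct vertices have $b$ or $c$ common neighbours; it is a strictly Deza graph if it has diameter $2$ and is not strongly regular. (A regular graph is strongly regular if any two adjacent vertices have the same number $\lambda$ of common neighbours and any two distinct non-adjacent vertices have the same number $\mu$ of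 common neighbours.) Then $\Gamma^{2\nu+1}$ is a strictly Deza graph with parameters $$\left(\frac{(p^{2m\nu}-1)\,p^{m(s-1)(2\nu-1)}}{p^m-1},\; p^{ms(2\nu-1)},\; (p^m-1)\,p^{m(2s\nu-s-1)},\; p^{ms(2\nu-1)}\right).$$ -/

import Mathlib

open Matrix

/-- `R` is the Galois ring of characteristic `p ^ s` and cardinality `p ^ (s * m)`: a finite
commutative ring whose zero divisors, together with `0`, form the principal ideal `(p)`. -/
structure IsGaloisRing (p s m : ℕ) (R : Type*) [CommRing R] : Prop where
  prime : p.Prime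
  finite : Finite R
  charP : CharP R (p ^ s)
  card : Nat.card R = p ^ (s * m)
  zeroDivisors : {x : R | ∃ y : R, y ≠ 0 ∧ x * y = 0} = (Ideal.span {(p : R)} : Set R)

namespace Orthogonal

variable {R : Type*} [CommRing R] {ι : Type*} {δ : ℕ}

/-- Coordinates `1, …, 2ν + δ`, grouped as `ν + ν + δ`. -/
abbrev Idx (ν δ : ℕ) : Type := (Fin ν ⊕ Fin ν) ⊕ Fin δ

/-- The block matrix with blocks `0, I; I, 0` of order `2ν`, followed by the diagonal block
`Δ = diag (d)` of order `δ`. -/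
def formMatrix (ν : ℕ) (d : Fin δ → R) : Matrix (Idx ν δ) (Idx ν δ) R :=
  Matrix.fromBlocks (Matrix.fromBlocks 0 1 1 0) 0 0 (Matrix.diagonal d)

/-- The value `α S βᵗ`. -/
def form (ν : ℕ) (d : Fin δ → R) (α β : Idx ν δ → R) : R :=
  α ⬝ᵥ (formMatrix ν d *ᵥ β)

/-- Tuples with at least one unit coordinate. -/
def UnitTuple (R : Type*) [CommRing R] (ι : Type*) : Type _ :=
  {v : ι → R // ∃ i, IsUnit (v i)}

/-- Two tuples are equivalent if they differ by a unit factor. -/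
instance unitTupleSetoid (R : Type*) [CommRing R] (ι : Type*) : Setoid (UnitTuple R ι) where
  r a b := ∃ u : Rˣ, a.1 = (u : R) • b.1
  iseqv :=
    { refl := fun a => ⟨1, by simp⟩
      symm := fun {a b} h => by
        obtain ⟨u, hu⟩ := h
        exact ⟨u⁻¹, by rw [hu, smul_smul, Units.inv_mul, one_smul]⟩
      trans := fun {a b c} h h' => by
        obtain ⟨u, hu⟩ := h
        obtain ⟨v, hv⟩ := h'
        exact ⟨u * v, by rw [hu, hv, smul_smul, Units.val_mul]⟩ }

/-- The equivalence classes `[a₁, a₂, …]`. -/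
def Point (R : Type*) [CommRing R] (ι : Type*) : Type _ :=
  Quotient (unitTupleSetoid R ι)

/-- The class of a tuple. -/
def Point.mk (a : UnitTuple R ι) : Point R ι := Quotient.mk (unitTupleSetoid R ι) a

/-- The vertices: classes `[α]` with `α S αᵗ = 0`. -/
def Vertex (ν : ℕ) (d : Fin δ → R) : Type _ :=
  {P : Point R (Idx ν δ) // ∃ α : UnitTuple R (Idx ν δ), Point.mk α = P ∧ form ν d α.1 α.1 = 0}

theorem form_comm (ν : ℕ) (d : Fin δ → R) (α β : Idx ν δ → R) :
    form ν d α β = form ν d β α := by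
  have h : (formMatrix ν d)ᵀ = formMatrix ν d := by
    simp [formMatrix, Matrix.fromBlocks_transpose]
  unfold form
  rw [Matrix.dotProduct_mulVec, ← Matrix.mulVec_transpose, h, dotProduct_comm]

theorem form_smul_smul (ν : ℕ) (d : Fin δ → R) (a b : R) (α β : Idx ν δ → R) :
    form ν d (a • α) (b • β) = a * b * form ν d α β := by
  simp only [form, Matrix.mulVec_smul, dotProduct_smul, smul_dotProduct, smul_eq_mul]
  ring

/-- The orthogonal graph `Γ^{2ν+δ}` for `Δ = diag (d)`: `[α]` and `[β]` are adjacent if `α S βᵗ`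
is a unit. The condition `P ≠ Q` is automatic over a nontrivial ring, see `graph_adj_iff`. -/
def graph (ν : ℕ) (d : Fin δ → R) : SimpleGraph (Vertex ν d) where
  Adj P Q := P ≠ Q ∧ ∃ α β : UnitTuple R (Idx ν δ),
    Point.mk α = P.1 ∧ Point.mk β = Q.1 ∧ IsUnit (form ν d α.1 β.1)
  symm := ⟨fun _ _ ⟨hne, α, β, hα, hβ, h⟩ =>
    ⟨hne.symm, β, α, hβ, hα, form_comm ν d α.1 β.1 ▸ h⟩⟩
  loopless := ⟨fun _ h => h.1 rfl⟩

/-- Isotropy does not depend on the representative. -/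
theorem form_self_of_mk_eq {ν : ℕ} {d : Fin δ → R} (P : Vertex ν d)
    {α : UnitTuple R (Idx ν δ)} (hα : Point.mk α = P.1) : form ν d α.1 α.1 = 0 := by
  obtain ⟨β, hβ, h⟩ := P.2
  obtain ⟨u, hu⟩ := Quotient.exact (hα.trans hβ.symm)
  rw [hu, form_smul_smul, h, mul_zero]

/-- Adjacency does not depend on the representatives. -/
theorem graph_adj_iff [Nontrivial R] {ν : ℕ} {d : Fin δ → R} (P Q : Vertex ν d)
    {α β : UnitTuple R (Idx ν δ)} (hα : Point.mk α = P.1) (hβ : Point.mk β = Q.1) :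
    (graph ν d).Adj P Q ↔ IsUnit (form ν d α.1 β.1) := by
  constructor
  · rintro ⟨-, α', β', hα', hβ', h⟩
    obtain ⟨u, hu⟩ := Quotient.exact (hα.trans hα'.symm)
    obtain ⟨v, hv⟩ := Quotient.exact (hβ.trans hβ'.symm)
    rw [hu, hv, form_smul_smul]
    exact (u.isUnit.mul v.isUnit).mul h
  · intro h
    refine ⟨?_, α, β, hα, hβ, h⟩
    rintro rfl
    obtain ⟨v, hv⟩ := Quotient.exact (hβ.trans hα.symm)
    have h0 := form_self_of_mk_eq P hα
    have h1 : form ν d α.1 β.1 = 0 := by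
      have := form_smul_smul ν d 1 (v : R) α.1 α.1
      rwa [one_smul, ← hv, h0, mul_zero] at this
    rw [h1] at h
    exact not_isUnit_zero h

end Orthogonal

/-- `G` is strongly regular, for some parameters. -/
def IsStronglyRegular {V : Type*} (G : SimpleGraph V) : Prop :=
  ∃ (_ : Fintype V) (_ : DecidableEq V) (_ : DecidableRel G.Adj) (n k l μ : ℕ),
    G.IsSRGWith n k l μ

/-- `(n, k, b, c)`-Deza graphs: regular graphs of valency `k` on `n` vertices in which any two
distinct vertices have `b` or `c` common neighbours. -/
structure IsDezaGraph {V : Type*} (G : SimpleGraph V) (n k b c : ℕ) : Prop where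
  finite : Finite V
  card : Nat.card V = n
  regular : ∀ v, (G.neighborSet v).ncard = k
  common : ∀ v w, v ≠ w →
    (G.commonNeighbors v w).ncard = b ∨ (G.commonNeighbors v w).ncard = c

/-- Strictly Deza graphs: Deza graphs of diameter `2` that are not strongly regular. -/
structure IsStrictlyDezaGraph {V : Type*} (G : SimpleGraph V) (n k b c : ℕ) : Prop where
  deza : IsDezaGraph G n k b c
  diam : G.ediam = 2
  not_stronglyRegular : ¬ IsStronglyRegular G

/-!
Let `𝔪 = (p)` be the maximal ideal of `R`, let `F = R / 𝔪` be the residue field, `q = |F| = p ^ m`,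
`n = 2 * ν + 1`, and let `B` be the bilinear form with matrix `S`. Since `|R| = q ^ s`, all counts
are expressed through `q`, `|R|`, `|Rˣ|` and `|𝔪|`.

**Common neighbours.** A common neighbour of `[α]` and `[α']` has a unique representative `β` with
`B α β = 1` (`Orthogonal.ncard_commonNeighbors`). On `{β | B α β = 1}` the translation
`β ↦ β + t • α` adds `2 * t` to `B β β`, so each orbit contains exactly one isotropic vector.
Letting `β` run over whole orbits and scaling by units turns the count into that of the `β` for
which `B α β` and `2 * B α β * B α' β - B α' α * B β β` are units
(`card_units_mul_card_mul_card_isotropic`). These conditions only involve residues, so the problem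
is reduced to one over `F`.

**The count over `F`.** If the residues of `α` and `α'` are proportional, the only condition is
`B α β ≠ 0`; the case `α = α'` gives the valency. If they are independent and orthogonal, the
conditions are `B α β ≠ 0` and `B α' β ≠ 0`. If they are not orthogonal, the space splits as a
hyperbolic plane plus its orthogonal complement `W`, and the condition becomes `B α β ≠ 0` and
`B w w ≠ 0` for the component `w` in `W`. The number of isotropic vectors of `W` need not be found
from a classification of forms: counting all isotropic vectors along the splitting
(`card_isotropic_eq`) expresses it through the total number `q ^ (2 * ν)`
(`Orthogonal.card_isotropic_mul`). Because the order is odd, the answer is the same as for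
orthogonal residues (`card_of_independent_mul`). So there are only two values.

**Vertices.** Every nonzero isotropic vector over `F` lifts to `|𝔪| ^ (n - 1)` isotropic vectors
over `R`, by the same argument with translations by an isotropic unit vector
(`Orthogonal.card_isotropic_lifts_mul`); division by `|Rˣ|` counts the classes.

**Diameter and failure of strong regularity.** Both values are positive. Let `e₁`, `e₂` be the
first two standard basis vectors. The pairs `[e₁]`, `[e₁ + p e₂]` and `[e₁]`, `[e₂]` are distinct
and non-adjacent, and they realize the two different values (`Orthogonal.exists_not_adj`); this
uses `ν ≥ 2` and `p ≠ 0` in `R`.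
-/

/-! ### Counting preimages under homomorphisms -/

theorem AddMonoidHom.card_preimage_eq_mul_card_ker {G H : Type*} [AddCommGroup G] [AddCommGroup H]
    (f : G →+ H) (hf : Function.Surjective f) (P : H → Prop) :
    Nat.card {g // P (f g)} = Nat.card {h // P h} * Nat.card f.ker := by
  rw [← Nat.card_prod]
  refine Nat.card_congr
    { toFun := fun g => (⟨f g.1, g.2⟩, ⟨g.1 - Function.surjInv hf (f g.1), ?_⟩)
      invFun := fun x => ⟨Function.surjInv hf x.1.1 + x.2.1, ?_⟩
      left_inv := ?_
      right_inv := ?_ }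
  · simp [AddMonoidHom.mem_ker, Function.surjInv_eq]
  · have h2 := x.2.2
    rw [AddMonoidHom.mem_ker] at h2
    rw [map_add, h2, add_zero, Function.surjInv_eq hf]
    exact x.1.2
  · intro g
    ext
    simp
  · rintro ⟨⟨h, hh⟩, ⟨k, hk⟩⟩
    rw [AddMonoidHom.mem_ker] at hk
    simp [Function.surjInv_eq, hk]

theorem AddMonoidHom.card_preimage_mul_card {G H : Type*} [AddCommGroup G] [AddCommGroup H]
    (f : G →+ H) (hf : Function.Surjective f) (P : H → Prop) :
    Nat.card {g // P (f g)} * Nat.card H = Nat.card G * Nat.card {h // P h} := by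
  have h1 := f.card_preimage_eq_mul_card_ker hf P
  have h2 := f.card_preimage_eq_mul_card_ker hf (fun _ => True)
  rw [Nat.card_congr (Equiv.subtypeUnivEquiv fun _ => trivial),
    Nat.card_congr (Equiv.subtypeUnivEquiv fun _ => trivial)] at h2
  rw [h1, h2]
  ring

theorem Nat.card_subtype_not {α : Type*} [Finite α] (P : α → Prop) :
    Nat.card {a // ¬ P a} = Nat.card α - Nat.card {a // P a} := by
  classical
  have := Fintype.ofFinite α
  simp only [Nat.card_eq_fintype_card]
  exact Fintype.card_subtype_compl P

theorem Nat.card_subtype_ne {α : Type*} [Finite α] (a : α) :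
    Nat.card {x // x ≠ a} = Nat.card α - 1 := by
  rw [Nat.card_subtype_not, Nat.card_unique (α := {x // x = a})]

/-! ### Galois rings as local rings -/

namespace IsGaloisRing

variable {p s m : ℕ} {R : Type*} [CommRing R]

theorem isUnit_iff (hR : IsGaloisRing p s m R) (x : R) :
    IsUnit x ↔ x ∉ Ideal.span {(p : R)} := by
  have := hR.finite
  rw [← SetLike.mem_coe, ← hR.zeroDivisors, isUnit_iff_mem_nonZeroDivisors_of_finite,
    mem_nonZeroDivisors_iff_right]
  simp only [Set.mem_ofPred_eq, not_exists, not_and, mul_comm x]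
  exact forall_congr' fun y => by tauto

theorem nontrivial (hR : IsGaloisRing p s m R) (hs : 2 ≤ s) : Nontrivial R := by
  have := hR.charP
  exact CharP.nontrivial_of_char_ne_one
    (Nat.one_lt_pow (by omega) hR.prime.one_lt : 1 < p ^ s).ne'

theorem isLocalRing (hR : IsGaloisRing p s m R) (hs : 2 ≤ s) : IsLocalRing R := by
  have := hR.nontrivial hs
  refine IsLocalRing.of_nonunits_add fun a b ha hb => ?_
  rw [mem_nonunits_iff, hR.isUnit_iff, not_not] at *
  exact add_mem ha hb

theorem maximalIdeal_eq [IsLocalRing R] (hR : IsGaloisRing p s m R) :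
    IsLocalRing.maximalIdeal R = Ideal.span {(p : R)} := by
  ext x
  rw [IsLocalRing.mem_maximalIdeal, mem_nonunits_iff, hR.isUnit_iff, not_not]

theorem isUnit_two [IsLocalRing R] (hR : IsGaloisRing p s m R) (hp2 : p ≠ 2) :
    IsUnit (2 : R) := by
  by_contra h
  obtain ⟨k, hk⟩ := hR.prime.odd_of_ne_two hp2
  have hpm : (p : R) ∈ IsLocalRing.maximalIdeal R := by
    rw [hR.maximalIdeal_eq]
    exact Ideal.mem_span_singleton_self _
  have h2 : (2 : R) ∈ IsLocalRing.maximalIdeal R := h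
  have h1 : (1 : R) ∈ IsLocalRing.maximalIdeal R := by
    have : (1 : R) = p - 2 * k := by rw [hk]; push_cast; ring
    rw [this]
    exact sub_mem hpm (Ideal.mul_mem_right _ _ h2)
  exact h1 isUnit_one

/-- Each quotient `(p ^ i) / (p ^ (i + 1))` with `i < s` is one-dimensional over the residue
field, because multiplication by `p ^ i` pulls `(p ^ (i + 1))` back to the maximal ideal. -/
theorem index_span_pow_succ [IsLocalRing R] (hR : IsGaloisRing p s m R) {i : ℕ} (hi : i < s) :
    (Ideal.span {(p : R) ^ (i + 1)}).toAddSubgroup.index =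
      Nat.card (IsLocalRing.ResidueField R) * (Ideal.span {(p : R) ^ i}).toAddSubgroup.index := by
  have := hR.charP
  have hpi : (p : R) ^ i ≠ 0 := by
    intro h0
    have h1 : p ^ s ∣ p ^ i := (CharP.cast_eq_zero_iff R (p ^ s) (p ^ i)).1 (by push_cast; exact h0)
    exact absurd ((Nat.pow_dvd_pow_iff_le_right hR.prime.one_lt).1 h1) (by omega)
  have hpm : (p : R) ∈ IsLocalRing.maximalIdeal R := by
    rw [hR.maximalIdeal_eq]
    exact Ideal.mem_span_singleton_self _
  let f : R →+ R := AddMonoidHom.mulLeft ((p : R) ^ i)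
  have hrange : f.range = (Ideal.span {(p : R) ^ i}).toAddSubgroup := by
    ext x
    simp [f, Ideal.mem_span_singleton', mul_comm]
  have hcomap : (Ideal.span {(p : R) ^ (i + 1)}).toAddSubgroup.comap f =
      (IsLocalRing.maximalIdeal R).toAddSubgroup := by
    ext x
    simp only [AddSubgroup.mem_comap, Submodule.mem_toAddSubgroup, f, AddMonoidHom.coe_mulLeft]
    constructor
    · intro hx
      by_contra hu
      rw [IsLocalRing.mem_maximalIdeal, mem_nonunits_iff, not_not] at hu
      obtain ⟨y, hy⟩ := Ideal.mem_span_singleton'.1 hx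
      have h1 : IsUnit (x - y * p) := by
        by_contra h
        have h : x - y * p ∈ IsLocalRing.maximalIdeal R := h
        have := add_mem h (Ideal.mul_mem_left _ y hpm)
        rw [sub_add_cancel] at this
        exact this hu
      apply hpi
      refine (h1.mul_left_eq_zero).1 ?_
      linear_combination -hy
    · intro hx
      rw [hR.maximalIdeal_eq] at hx
      obtain ⟨y, rfl⟩ := Ideal.mem_span_singleton'.1 hx
      exact Ideal.mem_span_singleton'.2 ⟨y, by ring⟩
  have hle : (Ideal.span {(p : R) ^ (i + 1)}).toAddSubgroup ≤
      (Ideal.span {(p : R) ^ i}).toAddSubgroup := by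
    have : Ideal.span {(p : R) ^ (i + 1)} ≤ Ideal.span {(p : R) ^ i} :=
      Ideal.span_singleton_le_span_singleton.2 (pow_dvd_pow _ (Nat.le_succ i))
    exact this
  rw [← AddSubgroup.relIndex_mul_index hle, ← hrange, ← AddSubgroup.index_comap, hcomap]
  rfl

theorem card_eq_card_residueField_pow [IsLocalRing R] (hR : IsGaloisRing p s m R) :
    Nat.card R = Nat.card (IsLocalRing.ResidueField R) ^ s := by
  have := hR.charP
  have key : ∀ i ≤ s, (Ideal.span {(p : R) ^ i}).toAddSubgroup.index =
      Nat.card (IsLocalRing.ResidueField R) ^ i := by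
    intro i
    induction i with
    | zero => intro _; simp
    | succ i ih =>
      intro hi
      rw [hR.index_span_pow_succ (by omega), ih (by omega), pow_succ']
  have h0 : (p : R) ^ s = 0 := by
    have := CharP.cast_eq_zero R (p ^ s)
    rwa [Nat.cast_pow] at this
  have := key s le_rfl
  rw [h0, Ideal.span_singleton_eq_bot.2 rfl] at this
  rw [← this]
  exact AddSubgroup.index_bot.symm

theorem card_residueField [IsLocalRing R] (hR : IsGaloisRing p s m R) (hs : 2 ≤ s) :
    Nat.card (IsLocalRing.ResidueField R) = p ^ m := by
  have h := hR.card_eq_card_residueField_pow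
  rw [hR.card, mul_comm, pow_mul] at h
  exact (Nat.pow_left_injective (n := s) (by omega) h).symm

end IsGaloisRing

/-! ### Finite local rings and their residue fields -/

section LocalRing

variable {R : Type*} [CommRing R] [IsLocalRing R]

open IsLocalRing

instance [Finite R] : Finite (ResidueField R) :=
  Finite.of_surjective _ (residue_surjective (R := R))

theorem residueField_two_ne_zero (h2 : IsUnit (2 : R)) : (2 : ResidueField R) ≠ 0 := by
  have := (residue_ne_zero_iff_isUnit (2 : R)).2 h2
  rwa [map_ofNat] at this

theorem card_units_mul_card_residueField [Finite R] :
    Nat.card Rˣ * Nat.card (ResidueField R) = Nat.card R * (Nat.card (ResidueField R) - 1) := by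
  have h := (residue R).toAddMonoidHom.card_preimage_mul_card residue_surjective (fun x => x ≠ 0)
  rw [Nat.card_subtype_ne] at h
  rw [← h]
  congr 1
  refine Nat.card_congr
    { toFun := fun u => ⟨u, (residue_ne_zero_iff_isUnit _).2 u.isUnit⟩
      invFun := fun x => ((residue_ne_zero_iff_isUnit _).1 x.2).unit
      left_inv := fun u => by ext; rfl
      right_inv := fun x => rfl }

theorem card_maximalIdeal_mul_card_residueField :
    Nat.card (maximalIdeal R) * Nat.card (ResidueField R) = Nat.card R := by
  have h := (residue R).toAddMonoidHom.card_preimage_mul_card residue_surjective (fun x => x = 0)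
  rw [Nat.card_unique (α := {x : ResidueField R // x = 0}), mul_one] at h
  rw [← h]
  congr 1
  exact Nat.card_congr (Equiv.subtypeEquivRight fun x => (residue_eq_zero_iff x).symm)

/-- A condition on tuples over `R` that only depends on residues is counted over the residue
field. -/
theorem card_residue_preimage {ι : Type*} [Fintype ι] (P : (ι → ResidueField R) → Prop) :
    Nat.card {β : ι → R // P fun i => residue R (β i)} *
        Nat.card (ResidueField R) ^ Fintype.card ι =
      Nat.card R ^ Fintype.card ι * Nat.card {β : ι → ResidueField R // P β} := by
  have h := ((residue R).toAddMonoidHom.compLeft ι).card_preimage_mul_card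
    (fun y => ⟨fun i => Function.surjInv residue_surjective (y i),
      funext fun i => Function.surjInv_eq _ _⟩) P
  rw [Nat.card_fun, Nat.card_fun, Nat.card_eq_fintype_card (α := ι)] at h
  exact h

end LocalRing

/-! ### Pairs of vectors in a symmetric bilinear space -/

section Translation

variable {R V : Type*} [CommRing R] [AddCommGroup V] [Module R V]

/-- The map `(u, t, β) ↦ u • (β + t • α)` identifies `Rˣ × R × X`, for `X` the isotropic vectors
`β` with `B α β = 1` and `B α' β` a unit, with a set cut out by conditions that only depend on
residues: on `{β | B α β = 1}` every translation orbit of `α` has exactly one isotropic vector. -/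
theorem card_units_mul_card_mul_card_isotropic (B : LinearMap.BilinForm R V)
    (hB : ∀ x y, B x y = B y x) (h2 : IsUnit (2 : R)) (α α' : V) (hα : B α α = 0) :
    Nat.card Rˣ * Nat.card R *
        Nat.card {β : V // B α β = 1 ∧ B β β = 0 ∧ IsUnit (B α' β)} =
      Nat.card {β : V // IsUnit (B α β) ∧
        IsUnit (2 * B α β * B α' β - B α' α * B β β)} := by
  rw [← Nat.card_prod, ← Nat.card_prod]
  obtain ⟨c, hc⟩ := h2.exists_left_inv
  have hexp : ∀ (u t : R) (β : V), B α (u • (β + t • α)) = u * B α β ∧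
      B α' (u • (β + t • α)) = u * (B α' β + t * B α' α) ∧
      B (u • (β + t • α)) (u • (β + t • α)) = u * u * (B β β + 2 * t * B α β) := by
    intro u t β
    refine ⟨?_, ?_, ?_⟩
    · simp [hα]
    · simp only [map_smul, map_add, smul_eq_mul]
    · simp only [map_smul, map_add, LinearMap.smul_apply, LinearMap.add_apply, smul_eq_mul, hα,
        hB β α]
      ring
  refine Nat.card_congr
    (Equiv.ofBijective (fun x => ⟨(x.1.1 : R) • (x.2.1 + x.1.2 • α), ?_⟩) ⟨?_, ?_⟩)
  · obtain ⟨⟨u, t⟩, β, h1, h0, hu⟩ := x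
    obtain ⟨e1, e2, e3⟩ := hexp u t β
    simp only [e1, e2, e3, h1, h0]
    refine ⟨by simp, ?_⟩
    have : 2 * (u * 1 : R) * (u * (B α' β + t * B α' α)) -
        B α' α * (u * u * (0 + 2 * t * 1)) = 2 * u * u * B α' β := by ring
    rw [this]
    exact ((h2.mul u.isUnit).mul u.isUnit).mul hu
  · rintro ⟨⟨u, t⟩, β, h1, h0, hu⟩ ⟨⟨u', t'⟩, β', h1', h0', hu'⟩ h
    have h := congrArg Subtype.val h
    dsimp only at h
    have e1 := (hexp u t β).1
    rw [h, (hexp u' t' β').1, h1, h1', mul_one, mul_one] at e1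
    obtain rfl := Units.ext e1
    have h' : β' + t' • α = β + t • α := by
      have := congrArg (fun x => ((u'⁻¹ : Rˣ) : R) • x) h
      simpa [smul_smul] using this.symm
    have e3 := (hexp 1 t β).2.2
    rw [← h', (hexp 1 t' β').2.2, h1, h1', h0, h0'] at e3
    obtain rfl : t' = t := by linear_combination c * e3 + (t - t') * hc
    obtain rfl := add_right_cancel h'
    rfl
  · rintro ⟨β, ⟨u, hu⟩, h⟩
    -- the scaling is read off from `B α β`, the translation from the value of the quadratic form
    obtain ⟨γ, hγ⟩ : ∃ γ : V, γ = ((u⁻¹ : Rˣ) : R) • β := ⟨_, rfl⟩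
    have hβ : β = (u : R) • γ := by simp [hγ, smul_smul]
    have h1 : B α γ = 1 := by simp [hγ, ← hu]
    have e := hexp 1 (-(c * B γ γ)) γ
    simp only [one_smul, one_mul, h1, mul_one] at e
    obtain ⟨e1, e2, e3⟩ := e
    refine ⟨⟨(u, c * B γ γ), γ + (-(c * B γ γ)) • α, e1, ?_, ?_⟩, ?_⟩
    · rw [e3]
      linear_combination -(B γ γ) * hc
    · rw [e2]
      have e4 : 2 * B α β * B α' β - B α' α * B β β =
          (2 * u * u) * (B α' γ + -(c * B γ γ) * B α' α) := by
        rw [hβ]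
        simp only [map_smul, LinearMap.smul_apply, smul_eq_mul, h1]
        linear_combination (u * u * B γ γ * B α' α) * hc
      rw [e4] at h
      exact isUnit_of_mul_isUnit_right h
    · ext
      simp [hβ]

end Translation

section Field

variable {F V : Type*} [Field F] [AddCommGroup V] [Module F V] (B : LinearMap.BilinForm F V)

theorem card_mul_card_ne_zero [Finite F] {α : V} (hα : α ≠ 0) (hnd : ∀ x, x ≠ 0 → ∃ y, B x y ≠ 0) :
    Nat.card {β // B α β ≠ 0} * Nat.card F = Nat.card V * (Nat.card F - 1) := by
  have hs : Function.Surjective (B α).toAddMonoidHom := by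
    obtain ⟨γ, hγ⟩ := hnd α hα
    exact fun x => ⟨(x / B α γ) • γ, by simp [hγ]⟩
  have h := (B α).toAddMonoidHom.card_preimage_mul_card hs (fun x => x ≠ 0)
  rwa [Nat.card_subtype_ne] at h

theorem surjective_pair {α α' : V} (hα : α ≠ 0) (hα' : ∀ c : F, α' ≠ c • α)
    (hnd : ∀ x, x ≠ 0 → ∃ y, B x y ≠ 0) :
    Function.Surjective ((B α).prod (B α')).toAddMonoidHom := by
  obtain ⟨γ, hγ⟩ := hnd α hα
  -- a vector orthogonal to `α` but not to `α'`
  obtain ⟨δ, hδ, hδ'⟩ : ∃ δ, B α δ = 0 ∧ B α' δ ≠ 0 := by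
    obtain ⟨η, hη⟩ := hnd (α' - (B α' γ / B α γ) • α) (sub_ne_zero.2 (hα' _))
    refine ⟨η - (B α η / B α γ) • γ, by simp [hγ], ?_⟩
    intro h0
    apply hη
    simp only [map_sub, map_smul, smul_eq_mul, LinearMap.sub_apply, LinearMap.smul_apply] at h0 ⊢
    rw [← h0]
    ring
  rintro ⟨x, y⟩
  refine ⟨(x / B α γ) • γ + ((y - x / B α γ * B α' γ) / B α' δ) • δ, ?_⟩
  ext
  · simp [hγ, hδ]
  · simp [hδ']

theorem card_orthogonal_pair_mul {α α' : V} (hα : α ≠ 0) (hα' : ∀ c : F, α' ≠ c • α)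
    (hnd : ∀ x, x ≠ 0 → ∃ y, B x y ≠ 0) :
    Nat.card {β // B α β = 0 ∧ B α' β = 0} * Nat.card F ^ 2 = Nat.card V := by
  have h := ((B α).prod (B α')).toAddMonoidHom.card_preimage_mul_card
    (surjective_pair B hα hα' hnd) (fun x => x = 0)
  rw [Nat.card_unique (α := {x : F × F // x = 0}), mul_one, Nat.card_prod, ← sq] at h
  rw [← h]
  congr 1
  exact Nat.card_congr (Equiv.subtypeEquivRight fun x => by simp [Prod.ext_iff])

/-- Vectors that are non-orthogonal to each of two independent orthogonal vectors. -/
theorem card_of_orthogonal_mul [Finite F] {α α' : V} (hα : α ≠ 0) (hα' : ∀ c : F, α' ≠ c • α)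
    (hnd : ∀ x, x ≠ 0 → ∃ y, B x y ≠ 0) :
    Nat.card {β // B α β ≠ 0 ∧ B α' β ≠ 0} * Nat.card F ^ 2 =
      Nat.card V * (Nat.card F - 1) ^ 2 := by
  have h := ((B α).prod (B α')).toAddMonoidHom.card_preimage_mul_card
    (surjective_pair B hα hα' hnd) (fun x => x.1 ≠ 0 ∧ x.2 ≠ 0)
  rw [Nat.card_prod, ← sq] at h
  rw [Nat.card_congr (Equiv.subtypeProdEquivProd
    (p := fun x : F => x ≠ 0) (q := fun x : F => x ≠ 0)), Nat.card_prod,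
    Nat.card_subtype_ne, ← sq] at h
  exact h

/-- The splitting of the space into the hyperbolic plane of two non-orthogonal isotropic vectors
and its orthogonal complement. -/
noncomputable def hyperbolicSplitting (hB : ∀ x y, B x y = B y x) {α α' : V} (hα : B α α = 0)
    (hα' : B α' α' = 0) (he : B α' α ≠ 0) :
    (F × F) × {w : V // B α w = 0 ∧ B α' w = 0} ≃ V where
  toFun x := x.1.1 • α + x.1.2 • α' + x.2.1
  invFun β := ((B α' β / B α' α, B α β / B α' α),
    ⟨β - (B α' β / B α' α) • α - (B α β / B α' α) • α', by
      constructor <;> simp [hα, hα', hB α α', he]⟩)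
  left_inv := by
    rintro ⟨⟨a, b⟩, w, h1, h2⟩
    have ha : B α' (a • α + b • α' + w) / B α' α = a := by
      simp [hα', h2, he]
    have hb : B α (a • α + b • α' + w) / B α' α = b := by
      simp [hα, h1, hB α α', he]
    ext
    · exact ha
    · exact hb
    · simp only [ha, hb]
      abel
  right_inv β := by
    dsimp only
    abel

theorem hyperbolicSplitting_form (hB : ∀ x y, B x y = B y x) {α α' : V} (hα : B α α = 0)
    (hα' : B α' α' = 0) (he : B α' α ≠ 0)
    (x : (F × F) × {w : V // B α w = 0 ∧ B α' w = 0}) :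
    let β := hyperbolicSplitting B hB hα hα' he x
    B α β = x.1.2 * B α' α ∧ B α' β = x.1.1 * B α' α ∧
      B β β = 2 * x.1.1 * x.1.2 * B α' α + B x.2.1 x.2.1 := by
  obtain ⟨⟨a, b⟩, w, h1, h2⟩ := x
  refine ⟨?_, ?_, ?_⟩
  · simp [hyperbolicSplitting, hα, h1, hB α α']
  · simp [hyperbolicSplitting, hα', h2]
  · simp only [hyperbolicSplitting, Equiv.coe_fn_mk, map_smul, map_add, LinearMap.smul_apply,
      LinearMap.add_apply, smul_eq_mul, hα, hα', h1, h2, hB α α', hB w α, hB w α']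
    ring

/-- Counting isotropic vectors along a hyperbolic splitting: if the coefficient of `α'` is nonzero
then that of `α` is determined, and otherwise the component in the complement is isotropic. -/
theorem card_isotropic_eq [Finite F] [Finite V] (hB : ∀ x y, B x y = B y x) (h2 : (2 : F) ≠ 0)
    {α α' : V} (hα : B α α = 0) (hα' : B α' α' = 0) (he : B α' α ≠ 0) :
    Nat.card {β // B β β = 0} =
      (Nat.card F - 1) * Nat.card {w : V // B α w = 0 ∧ B α' w = 0} + Nat.card F *
        Nat.card {w : {w : V // B α w = 0 ∧ B α' w = 0} // B w.1 w.1 = 0} := by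
  rw [← Nat.card_subtype_ne (0 : F), ← Nat.card_prod, ← Nat.card_prod, ← Nat.card_sum]
  let E := hyperbolicSplitting B hB hα hα' he
  have hE := fun x => (hyperbolicSplitting_form B hB hα hα' he x).2.2
  have h3 : ∀ x : {b : F // b ≠ 0} × {w : V // B α w = 0 ∧ B α' w = 0},
      B (E ((-(B x.2.1 x.2.1) / (2 * x.1 * B α' α), x.1), x.2))
        (E ((-(B x.2.1 x.2.1) / (2 * x.1 * B α' α), x.1), x.2)) = 0 := by
    intro x
    have := x.1.2
    rw [hE]
    field_simp
    ring
  have h4 : ∀ x : F × {w : {w : V // B α w = 0 ∧ B α' w = 0} // B w.1 w.1 = 0},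
      B (E ((x.1, 0), x.2.1)) (E ((x.1, 0), x.2.1)) = 0 := by
    intro x
    rw [hE]
    simp [x.2.2]
  refine (Nat.card_congr (Equiv.ofBijective (Sum.elim
    (fun x => ⟨E ((-(B x.2.1 x.2.1) / (2 * x.1 * B α' α), x.1), x.2), h3 x⟩)
    (fun x => ⟨E ((x.1, 0), x.2.1), h4 x⟩)) ⟨?_, ?_⟩)).symm
  · rintro (⟨⟨b, hb⟩, w⟩ | ⟨a, w, hw⟩) (⟨⟨b', hb'⟩, w'⟩ | ⟨a', w', hw'⟩) h <;>
      simp only [Sum.elim_inl, Sum.elim_inr, Subtype.mk.injEq, EmbeddingLike.apply_eq_iff_eq,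
        Prod.mk.injEq] at h
    · obtain ⟨⟨-, rfl⟩, rfl⟩ := h
      rfl
    · exact absurd h.1.2 hb
    · exact absurd h.1.2.symm hb'
    · obtain ⟨⟨rfl, -⟩, rfl⟩ := h
      rfl
  · rintro ⟨β, hβ⟩
    obtain ⟨⟨⟨a, b⟩, w⟩, rfl⟩ := E.surjective β
    rw [hE] at hβ
    by_cases hb : b = 0
    · subst hb
      exact ⟨Sum.inr (a, ⟨w, by simpa using hβ⟩), rfl⟩
    · refine ⟨Sum.inl (⟨b, hb⟩, w), ?_⟩
      ext
      simp only [Sum.elim_inl]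
      congr 3
      rw [div_eq_iff (by simp [h2, hb, he])]
      linear_combination -hβ

/-- In the coordinates of the hyperbolic splitting the second condition says that the component in
the complement is not isotropic. -/
theorem card_of_not_orthogonal [Finite F] [Finite V] (hB : ∀ x y, B x y = B y x) {α α' : V}
    (hα : B α α = 0) (hα' : B α' α' = 0) (he : B α' α ≠ 0) :
    Nat.card {β // B α β ≠ 0 ∧ 2 * B α β * B α' β - B α' α * B β β ≠ 0} =
      Nat.card F * (Nat.card F - 1) * (Nat.card {w : V // B α w = 0 ∧ B α' w = 0} -
        Nat.card {w : {w : V // B α w = 0 ∧ B α' w = 0} // B w.1 w.1 = 0}) := by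
  rw [← Nat.card_subtype_ne (0 : F), ← Nat.card_subtype_not, ← Nat.card_prod, ← Nat.card_prod]
  let E := hyperbolicSplitting B hB hα hα' he
  have hE := fun x => hyperbolicSplitting_form B hB hα hα' he x
  have hiff : ∀ x, (B α (E x) ≠ 0 ∧ 2 * B α (E x) * B α' (E x) - B α' α * B (E x) (E x) ≠ 0) ↔
      x.1.2 ≠ 0 ∧ ¬ B x.2.1 x.2.1 = 0 := by
    intro x
    obtain ⟨e1, e2, e3⟩ := hE x
    have e4 : 2 * B α (E x) * B α' (E x) - B α' α * B (E x) (E x) =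
        -(B α' α) * B x.2.1 x.2.1 := by
      rw [e1, e2, e3]
      ring
    rw [e4, e1]
    simp [he]
  refine (Nat.card_congr (Equiv.ofBijective
    (fun x => ⟨E ((x.1.1, x.1.2), x.2), (hiff _).2 ⟨x.1.2.2, x.2.2⟩⟩) ⟨?_, ?_⟩)).symm
  · rintro ⟨⟨a, b, hb⟩, w, hw⟩ ⟨⟨a', b', hb'⟩, w', hw'⟩ h
    simp only [Subtype.mk.injEq, EmbeddingLike.apply_eq_iff_eq, Prod.mk.injEq]
      at h
    obtain ⟨⟨rfl, rfl⟩, rfl⟩ := h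
    rfl
  · rintro ⟨β, hβ⟩
    obtain ⟨⟨⟨a, b⟩, w⟩, rfl⟩ := E.surjective β
    have := (hiff _).1 hβ
    exact ⟨((a, ⟨b, this.1⟩), ⟨w, this.2⟩), rfl⟩

/-- If the number of isotropic vectors is `|V| / |F|`, as in odd dimension, then the count does not
depend on whether the two independent isotropic vectors are orthogonal. -/
theorem card_of_independent_mul [Finite F] [Finite V] (hB : ∀ x y, B x y = B y x)
    (hnd : ∀ x, x ≠ 0 → ∃ y, B x y ≠ 0) (h2 : (2 : F) ≠ 0)
    (hT : Nat.card {β // B β β = 0} * Nat.card F = Nat.card V) {α α' : V} (h0 : α ≠ 0)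
    (hind : ∀ c : F, α' ≠ c • α) (hα : B α α = 0) (hα' : B α' α' = 0) :
    Nat.card {β // B α β ≠ 0 ∧ 2 * B α β * B α' β - B α' α * B β β ≠ 0} * Nat.card F ^ 2 =
      Nat.card V * (Nat.card F - 1) ^ 2 := by
  by_cases he : B α' α = 0
  · rw [← card_of_orthogonal_mul B h0 hind hnd]
    congr 1
    refine Nat.card_congr (Equiv.subtypeEquivRight fun β => ?_)
    rw [he, zero_mul, sub_zero]
    simp only [ne_eq, mul_eq_zero, h2, false_or]
    tauto
  · rw [card_of_not_orthogonal B hB hα hα' he]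
    have hW := card_orthogonal_pair_mul B h0 hind hnd
    have hI := card_isotropic_eq B hB h2 hα hα' he
    obtain ⟨q, hq⟩ : ∃ q, Nat.card F = q + 1 :=
      Nat.exists_eq_add_of_le' (Nat.card_pos (α := F))
    generalize Nat.card {w : V // B α w = 0 ∧ B α' w = 0} = W at *
    generalize Nat.card {w : {w : V // B α w = 0 ∧ B α' w = 0} // B w.1 w.1 = 0} = N at *
    rw [hI, ← hW] at hT
    rw [← hW]
    rw [hq, Nat.add_sub_cancel] at hT ⊢
    -- the two counts force the complement to have `|W| / |F|` isotropic vectors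
    obtain rfl : W = (q + 1) * N := by
      have hq0 : q + 1 ≠ 0 := by omega
      have h1 : (q + 1) * (q * W + (q + 1) * N) = (q + 1) * (q * W + W) := by
        linear_combination hT
      have := mul_left_cancel₀ hq0 h1
      omega
    rw [show (q + 1) * N - N = q * N by rw [add_mul, one_mul, Nat.add_sub_cancel]]
    ring

end Field

/-! ### Isotropic vectors in orbits of isotropic translations -/

/-- If `g β` is isotropic, pairs with `β` to a unit and is constant along the translations
`β + t • g β` with `t ∈ I`, then each such orbit on which the quadratic form takes values in `I`
contains exactly one isotropic vector. -/
theorem card_ideal_mul_card_isotropic {R V : Type*} [CommRing R] [AddCommGroup V] [Module R V]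
    (B : LinearMap.BilinForm R V) (hB : ∀ x y, B x y = B y x) (h2 : IsUnit (2 : R)) (I : Ideal R)
    (P : V → Prop) (g : V → V) (hg : ∀ β, P β → B (g β) (g β) = 0)
    (hu : ∀ β, P β → IsUnit (B β (g β)))
    (hP : ∀ β, P β → ∀ t ∈ I, P (β + t • g β) ∧ g (β + t • g β) = g β) :
    Nat.card I * Nat.card {β // P β ∧ B β β = 0} = Nat.card {β // P β ∧ B β β ∈ I} := by
  have hexp : ∀ β, P β → ∀ t, B (β + t • g β) (β + t • g β) = B β β + t * (2 * B β (g β)) := by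
    intro β hβ t
    simp only [map_smul, map_add, LinearMap.smul_apply, LinearMap.add_apply, smul_eq_mul, hg β hβ,
      hB (g β) β]
    ring
  rw [← Nat.card_prod]
  refine Nat.card_congr (Equiv.ofBijective (fun x =>
    ⟨x.2.1 + (x.1 : R) • g x.2.1, (hP _ x.2.2.1 _ x.1.2).1, ?_⟩) ⟨?_, ?_⟩)
  · rw [hexp _ x.2.2.1, x.2.2.2, zero_add]
    exact I.mul_mem_right _ x.1.2
  · rintro ⟨⟨t, ht⟩, β, hβ, h0⟩ ⟨⟨t', ht'⟩, β', hβ', h0'⟩ h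
    have h : β + t • g β = β' + t' • g β' := congrArg Subtype.val h
    have hgg : g β = g β' := by
      rw [← (hP β hβ t ht).2, h, (hP β' hβ' t' ht').2]
    have hBg : B β (g β) = B β' (g β') := by
      have := congrArg (fun x => B x (g β)) h
      simpa [hg β hβ, ← hgg] using this
    have e := hexp β hβ t
    rw [h, hexp β' hβ' t', h0, h0', zero_add, zero_add, hBg] at e
    obtain rfl : t' = t := (h2.mul (hu β' hβ')).mul_right_cancel e
    rw [hgg] at h
    obtain rfl := add_right_cancel h
    rfl
  · rintro ⟨β, hβ, hI⟩
    obtain ⟨c, hc⟩ := (h2.mul (hu β hβ)).exists_left_inv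
    have ht : -(B β β * c) ∈ I := neg_mem (I.mul_mem_right _ hI)
    obtain ⟨h1, h3⟩ := hP β hβ _ ht
    refine ⟨(⟨-(-(B β β * c)), neg_mem ht⟩, ⟨β + (-(B β β * c)) • g β, h1, ?_⟩), ?_⟩
    · rw [hexp β hβ]
      linear_combination -(B β β) * hc
    · refine Subtype.ext ?_
      change β + (-(B β β * c)) • g β + (-(-(B β β * c))) • g (β + (-(B β β * c)) • g β) = β
      rw [h3]
      module

theorem Nat.card_subtype_eq_add {α : Type*} [Finite α] (P Q : α → Prop) :
    Nat.card {a // Q a} = Nat.card {a // P a ∧ Q a} + Nat.card {a // ¬ P a ∧ Q a} := by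
  classical
  rw [← Nat.card_congr (Equiv.sumCompl fun a : {a // Q a} => P a.1), Nat.card_sum]
  congr 1
  · exact Nat.card_congr ((Equiv.subtypeSubtypeEquivSubtypeInter Q P).trans
      (Equiv.subtypeEquivRight fun a => and_comm))
  · exact Nat.card_congr ((Equiv.subtypeSubtypeEquivSubtypeInter Q fun a => ¬ P a).trans
      (Equiv.subtypeEquivRight fun a => and_comm))

namespace Orthogonal

/-! ### The orthogonal form of odd order -/

section Form

variable {R : Type*} [CommRing R] {ν : ℕ}

theorem card_idx (ν : ℕ) : Fintype.card (Idx ν 1) = 2 * ν + 1 := by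
  simp [Idx]
  ring

theorem form_eq (d : R) (α β : Idx ν 1 → R) :
    form ν ![d] α β = ∑ i, α (.inl (.inl i)) * β (.inl (.inr i)) +
      ∑ i, α (.inl (.inr i)) * β (.inl (.inl i)) + d * α (.inr 0) * β (.inr 0) := by
  have h1 : ∀ i, (formMatrix ν ![d] *ᵥ β) (.inl (.inl i)) = β (.inl (.inr i)) := by
    intro i
    simp [formMatrix, Matrix.mulVec, dotProduct, Matrix.one_apply]
  have h2 : ∀ i, (formMatrix ν ![d] *ᵥ β) (.inl (.inr i)) = β (.inl (.inl i)) := by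
    intro i
    simp [formMatrix, Matrix.mulVec, dotProduct, Matrix.one_apply]
  have h3 : (formMatrix ν ![d] *ᵥ β) (.inr 0) = d * β (.inr 0) := by
    simp [formMatrix, Matrix.mulVec, dotProduct]
  simp only [form, dotProduct, Fintype.sum_sum_type, h1, h2, Fin.sum_univ_one, h3]
  ring

/-- The symmetric bilinear form `(α, β) ↦ α S βᵗ`. -/
noncomputable def bilin (ν : ℕ) (d : R) : LinearMap.BilinForm R (Idx ν 1 → R) :=
  Matrix.toBilin' (formMatrix ν ![d])

theorem bilin_apply (d : R) (α β : Idx ν 1 → R) : bilin ν d α β = form ν ![d] α β :=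
  Matrix.toBilin'_apply' _ _ _

theorem bilin_comm (d : R) (α β : Idx ν 1 → R) : bilin ν d α β = bilin ν d β α := by
  rw [bilin_apply, bilin_apply, form_comm]

theorem bilin_single (d : R) (β : Idx ν 1 → R) (j : Fin ν ⊕ Fin ν) :
    bilin ν d β (Pi.single (.inl j.swap) 1) = β (.inl j) := by
  rw [bilin_apply, form_eq]
  cases j <;> simp [Pi.single_apply]

theorem bilin_single_self (d : R) (j : Fin ν ⊕ Fin ν) :
    bilin ν d (Pi.single (.inl j.swap) 1) (Pi.single (.inl j.swap) 1) = 0 := by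
  rw [bilin_single]
  cases j <;> simp

theorem bilin_self_of_hyperbolic_eq_zero (d : R) {β : Idx ν 1 → R}
    (h : ∀ j, β (.inl (.inl j)) = 0) : bilin ν d β β = d * β (.inr 0) * β (.inr 0) := by
  rw [bilin_apply, form_eq]
  simp [h]

theorem bilin_map {S : Type*} [CommRing S] (f : R →+* S) (d : R) (α β : Idx ν 1 → R) :
    bilin ν (f d) (fun i => f (α i)) (fun i => f (β i)) = f (bilin ν d α β) := by
  simp only [bilin_apply, form_eq, map_add, map_sum, map_mul]

theorem exists_bilin_ne_zero {F : Type*} [Field F] {d : F} (hd : d ≠ 0) (α : Idx ν 1 → F)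
    (hα : α ≠ 0) : ∃ β, bilin ν d α β ≠ 0 := by
  obtain ⟨i, hi⟩ := Function.ne_iff.1 hα
  obtain j | j := i
  · exact ⟨Pi.single (.inl j.swap) 1, by rwa [bilin_single]⟩
  · refine ⟨Pi.single (.inr 0) 1, ?_⟩
    obtain rfl : j = 0 := Subsingleton.elim _ _
    rw [bilin_apply, form_eq]
    simpa [hd] using hi

/-- The form of order `2 * ν + 1` over a finite field has `q ^ (2 * ν)` isotropic vectors. Write
a vector as `(x, y, z)` along the blocks of the matrix. If `x ≠ 0`, translations in a coordinate of
`y` meet the quadric exactly once; if `x = 0`, isotropic means `z = 0`. -/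
theorem card_isotropic_mul {F : Type*} [Field F] [Finite F] (h2 : (2 : F) ≠ 0) {d : F}
    (hd : d ≠ 0) :
    Nat.card {β : Idx ν 1 → F // bilin ν d β β = 0} * Nat.card F = Nat.card (Idx ν 1 → F) := by
  classical
  let P : (Idx ν 1 → F) → Prop := fun β => ∃ i, β (.inl (.inl i)) ≠ 0
  let g : (Idx ν 1 → F) → Idx ν 1 → F := fun β =>
    if h : P β then Pi.single (.inl (.inr h.choose)) 1 else 0
  have hg : ∀ β, P β → ∃ i, β (.inl (.inl i)) ≠ 0 ∧ g β = Pi.single (.inl (.inr i)) 1 := by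
    intro β hβ
    exact ⟨hβ.choose, hβ.choose_spec, by simp only [g, dif_pos hβ]⟩
  have hinv : ∀ β β', (∀ i, β (.inl (.inl i)) = β' (.inl (.inl i))) →
      (P β ↔ P β') ∧ g β = g β' := by
    intro β β' h
    have : P β = P β' := by simp only [P, h]
    refine ⟨by rw [this], ?_⟩
    simp only [g, P, h]
  have hne := card_ideal_mul_card_isotropic (bilin ν d) (bilin_comm d) h2.isUnit ⊤ P g
    (fun β hβ => by
      obtain ⟨i, -, hi⟩ := hg β hβ
      rw [hi]
      exact bilin_single_self d (.inl i))
    (fun β hβ => by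
      obtain ⟨i, h0, hi⟩ := hg β hβ
      rw [hi]
      have := bilin_single d β (.inl i)
      rw [Sum.swap_inl] at this
      rw [this]
      exact h0.isUnit)
    (fun β hβ t _ => by
      obtain ⟨i, -, hi⟩ := hg β hβ
      have := hinv (β + t • g β) β (fun j => by rw [hi]; simp)
      exact ⟨this.1.2 hβ, this.2⟩)
  rw [Nat.card_congr (Submodule.topEquiv (R := F) (M := F)).toEquiv] at hne
  simp only [Submodule.mem_top, and_true] at hne
  -- on the complement of `P` the form is `d z ^ 2`
  have hz : Nat.card {β // ¬ P β ∧ bilin ν d β β = 0} * Nat.card F = Nat.card {β // ¬ P β} := by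
    let f : (Idx ν 1 → F) →+ (Fin ν → F) :=
      { toFun := fun β i => β (.inl (.inl i)), map_zero' := rfl, map_add' := fun _ _ => rfl }
    let f' : (Idx ν 1 → F) →+ (Fin ν → F) × F :=
      { toFun := fun β => (fun i => β (.inl (.inl i)), β (.inr 0))
        map_zero' := rfl, map_add' := fun _ _ => rfl }
    have h1 := f.card_preimage_mul_card
      (fun y => ⟨Sum.elim (Sum.elim y 0) 0, rfl⟩) (fun x => x = 0)
    have h2 := f'.card_preimage_mul_card
      (fun y => ⟨Sum.elim (Sum.elim y.1 0) (fun _ => y.2), rfl⟩) (fun x => x = 0)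
    rw [Nat.card_unique (α := {x : Fin ν → F // x = 0})] at h1
    rw [Nat.card_unique (α := {x : (Fin ν → F) × F // x = 0}), ← h1, Nat.card_prod] at h2
    have h3 : ∀ β, f β = 0 ↔ ¬ P β := by
      intro β
      simp [P, f, funext_iff]
    have h4 : ∀ β, f' β = 0 ↔ ¬ P β ∧ bilin ν d β β = 0 := by
      intro β
      rw [← h3]
      constructor
      · intro h
        have hf : f β = 0 := congrArg Prod.fst h
        have hl : β (.inr 0) = 0 := congrArg Prod.snd h
        refine ⟨hf, ?_⟩
        rw [bilin_self_of_hyperbolic_eq_zero d (congrFun hf), hl, mul_zero]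
      · rintro ⟨hf, h⟩
        rw [bilin_self_of_hyperbolic_eq_zero d (congrFun hf)] at h
        exact Prod.ext hf (show β (.inr 0) = 0 by simpa [hd] using h)
    simp only [h3, h4] at h2
    have hpos : 0 < Nat.card (Fin ν → F) := Nat.card_pos
    refine Nat.eq_of_mul_eq_mul_right hpos ?_
    rw [← h2]
    ring
  rw [Nat.card_subtype_eq_add P, add_mul, hz, mul_comm, hne]
  have := Nat.card_subtype_eq_add P (fun _ => True)
  simp only [and_true] at this
  rw [← this]
  exact Nat.card_congr (Equiv.subtypeUnivEquiv fun _ => trivial)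

end Form

/-! ### Isotropic vectors over a finite local ring -/

section LocalRing

open IsLocalRing

variable {R : Type*} [CommRing R] [IsLocalRing R] {ν : ℕ}

theorem exists_isUnit_iff {ι : Type*} (β : ι → R) :
    (∃ i, IsUnit (β i)) ↔ (fun i => residue R (β i)) ≠ 0 := by
  rw [Function.ne_iff]
  exact exists_congr fun i => (residue_ne_zero_iff_isUnit _).symm

theorem exists_isUnit_of_isUnit_form {d : R} {α β : Idx ν 1 → R}
    (h : IsUnit (form ν ![d] α β)) : ∃ i, IsUnit (β i) := by
  rw [exists_isUnit_iff]
  intro h0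
  rw [← bilin_apply, ← residue_ne_zero_iff_isUnit, ← bilin_map, h0] at h
  simp at h

/-- Every nonzero isotropic vector over the residue field has the same number of isotropic lifts. -/
theorem card_isotropic_lifts_mul (h2 : IsUnit (2 : R)) {d : R} (hd : IsUnit d) :
    Nat.card (maximalIdeal R) *
        Nat.card {β : Idx ν 1 → R // (∃ i, IsUnit (β i)) ∧ bilin ν d β β = 0} =
      Nat.card {β : Idx ν 1 → R // (∃ i, IsUnit (β i)) ∧ bilin ν d β β ∈ maximalIdeal R} := by
  classical
  let P : (Idx ν 1 → ResidueField R) → Prop := fun β => ∃ j, β (.inl j) ≠ 0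
  let g : (Idx ν 1 → ResidueField R) → Idx ν 1 → R := fun β =>
    if h : P β then Pi.single (.inl h.choose.swap) 1 else 0
  let π : (Idx ν 1 → R) → Idx ν 1 → ResidueField R := fun β i => residue R (β i)
  have hg : ∀ β, P (π β) → ∃ j, IsUnit (β (.inl j)) ∧ g (π β) = Pi.single (.inl j.swap) 1 := by
    intro β hβ
    exact ⟨hβ.choose, (residue_ne_zero_iff_isUnit _).1 hβ.choose_spec,
      by simp only [g, dif_pos hβ]⟩
  have key := card_ideal_mul_card_isotropic (bilin ν d) (bilin_comm d) h2 (maximalIdeal R)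
    (fun β => P (π β)) (fun β => g (π β))
    (fun β hβ => by
      obtain ⟨j, -, hj⟩ := hg β hβ
      rw [hj]
      exact bilin_single_self d j)
    (fun β hβ => by
      obtain ⟨j, h0, hj⟩ := hg β hβ
      rw [hj, bilin_single]
      exact h0)
    (fun β hβ t ht => by
      have : π (β + t • g (π β)) = π β := by
        funext i
        simp [π, (residue_eq_zero_iff t).2 ht]
      rw [this]
      exact ⟨hβ, rfl⟩)
  -- a unimodular vector that is isotropic modulo the maximal ideal has a unit among its
  -- hyperbolic coordinates
  have hP : ∀ β, bilin ν d β β ∈ maximalIdeal R → (P (π β) ↔ ∃ i, IsUnit (β i)) := by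
    intro β hβ
    constructor
    · rintro ⟨j, hj⟩
      exact ⟨_, (residue_ne_zero_iff_isUnit _).1 hj⟩
    · rintro ⟨i, hi⟩
      by_contra hn
      have hn : ∀ j, π β (.inl j) = 0 := by simpa [P] using hn
      rw [← residue_eq_zero_iff, ← bilin_map,
        bilin_self_of_hyperbolic_eq_zero _ fun j => hn (.inl j)] at hβ
      rw [← residue_ne_zero_iff_isUnit] at hi hd
      obtain j | j := i
      · exact hi (hn j)
      · obtain rfl : j = 0 := Subsingleton.elim _ _
        have : π β (.inr 0) = 0 := by simpa [hd] using hβ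
        exact hi this
  rw [Nat.card_congr (Equiv.subtypeEquivRight fun β => and_congr_left fun h => (hP β h).symm),
    ← key]
  congr 1
  exact Nat.card_congr (Equiv.subtypeEquivRight fun β => and_congr_left fun h =>
    (hP β (by rw [h]; exact zero_mem _)).symm)

theorem card_isotropic_unitTuple_mul [Finite R] (h2 : IsUnit (2 : R)) {d : R} (hd : IsUnit d) :
    Nat.card (maximalIdeal R) *
        Nat.card {β : Idx ν 1 → R // (∃ i, IsUnit (β i)) ∧ bilin ν d β β = 0} =
      Nat.card (maximalIdeal R) ^ (2 * ν + 1) * (Nat.card (ResidueField R) ^ (2 * ν) - 1) := by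
  have hd' := (residue_ne_zero_iff_isUnit d).2 hd
  have h2' := residueField_two_ne_zero h2
  have hq : 0 < Nat.card (ResidueField R) := Nat.card_pos
  have hn := card_idx ν
  have hT := card_isotropic_mul (ν := ν) h2' hd'
  rw [Nat.card_fun, Nat.card_eq_fintype_card (α := Idx ν 1), hn, pow_succ] at hT
  have hT := Nat.eq_of_mul_eq_mul_right hq hT
  have h0 : Nat.card {β : Idx ν 1 → ResidueField R // β ≠ 0 ∧ bilin ν (residue R d) β β = 0} =
      Nat.card (ResidueField R) ^ (2 * ν) - 1 := by
    have h1 := Nat.card_subtype_eq_add (fun β : Idx ν 1 → ResidueField R => β = 0)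
      (fun β => bilin ν (residue R d) β β = 0)
    have h3 : Nat.card {β : Idx ν 1 → ResidueField R //
        β = 0 ∧ bilin ν (residue R d) β β = 0} = 1 := by
      exact (Nat.card_congr (Equiv.subtypeEquivRight fun β =>
        ⟨fun h => h.1, fun h => ⟨h, by subst h; simp⟩⟩)).trans
          (Nat.card_unique (α := {β : Idx ν 1 → ResidueField R // β = 0}))
    rw [h3, hT] at h1
    rw [h1, Nat.add_sub_cancel_left]
  have hr := card_residue_preimage (R := R)
    (fun β : Idx ν 1 → ResidueField R => β ≠ 0 ∧ bilin ν (residue R d) β β = 0)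
  rw [h0, hn, ← card_maximalIdeal_mul_card_residueField (R := R), mul_pow] at hr
  rw [card_isotropic_lifts_mul h2 hd]
  refine Nat.eq_of_mul_eq_mul_right (pow_pos hq (2 * ν + 1)) ?_
  rw [Nat.card_congr (Equiv.subtypeEquivRight fun β => and_congr (exists_isUnit_iff β)
    (by rw [← residue_eq_zero_iff, ← bilin_map])), hr]
  ring

end LocalRing

/-! ### The orthogonal graph over a finite local ring -/

section Graph

open IsLocalRing

variable {R : Type*} [CommRing R] {ν : ℕ}

theorem Vertex.exists_rep {d : R} (v : Vertex ν ![d]) :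
    ∃ α : UnitTuple R (Idx ν 1), Point.mk α = v.1 ∧ bilin ν d α.1 α.1 = 0 := by
  obtain ⟨α, h, h0⟩ := v.2
  exact ⟨α, h, by rwa [bilin_apply]⟩

/-- The vertex of an isotropic tuple. -/
def Vertex.mk {d : R} (α : UnitTuple R (Idx ν 1)) (hα : bilin ν d α.1 α.1 = 0) :
    Vertex ν ![d] :=
  ⟨Point.mk α, α, rfl, by rwa [← bilin_apply]⟩

theorem Point.mk_eq_iff {ι : Type*} {α β : UnitTuple R ι} :
    Point.mk α = Point.mk β ↔ ∃ u : Rˣ, α.1 = (u : R) • β.1 :=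
  Quotient.eq

theorem units_smul_left_cancel {ι : Type*} (α : UnitTuple R ι) {u v : Rˣ}
    (h : (u : R) • α.1 = (v : R) • α.1) : u = v := by
  obtain ⟨i, hi⟩ := α.2
  exact Units.ext (hi.mul_right_cancel (congrFun h i))

theorem finite_vertex [Finite R] (d : R) : Finite (Vertex ν ![d]) := by
  have : Finite (UnitTuple R (Idx ν 1)) := inferInstanceAs (Finite {v : Idx ν 1 → R // _})
  have : Finite (Point R (Idx ν 1)) := inferInstanceAs (Finite (Quotient _))
  exact inferInstanceAs (Finite {P : Point R (Idx ν 1) // _})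


theorem card_units_mul_card_vertex (d : R) :
    Nat.card Rˣ * Nat.card (Vertex ν ![d]) =
      Nat.card {β : Idx ν 1 → R // (∃ i, IsUnit (β i)) ∧ bilin ν d β β = 0} := by
  rw [← Nat.card_prod]
  choose rep hrep hiso using Vertex.exists_rep (ν := ν) (d := d)
  refine Nat.card_congr (Equiv.ofBijective (fun x => ⟨(x.1 : R) • (rep x.2).1, ?_, ?_⟩) ⟨?_, ?_⟩)
  · obtain ⟨i, hi⟩ := (rep x.2).2
    exact ⟨i, x.1.isUnit.mul hi⟩
  · simp [hiso]
  · rintro ⟨u, v⟩ ⟨u', v'⟩ h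
    have h : (u : R) • (rep v).1 = (u' : R) • (rep v').1 := congrArg Subtype.val h
    have hv : v = v' := by
      apply Subtype.ext
      rw [← hrep v, ← hrep v', Point.mk_eq_iff]
      exact ⟨u⁻¹ * u', by rw [Units.val_mul, mul_smul, ← h, smul_smul, Units.inv_mul, one_smul]⟩
    subst hv
    rw [units_smul_left_cancel _ h]
  · rintro ⟨β, hβ, h0⟩
    obtain ⟨u, hu⟩ := Point.mk_eq_iff.1 (hrep (Vertex.mk ⟨β, hβ⟩ h0)).symm
    exact ⟨(u, Vertex.mk ⟨β, hβ⟩ h0), Subtype.ext hu.symm⟩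

variable [IsLocalRing R]

/-- A common neighbour of `[α]` and `[α']` has a unique representative `β` with `B α β = 1`. -/
theorem ncard_commonNeighbors {d : R} (v w : Vertex ν ![d]) {α α' : UnitTuple R (Idx ν 1)}
    (hα : Point.mk α = v.1) (hα' : Point.mk α' = w.1) :
    ((graph ν ![d]).commonNeighbors v w).ncard =
      Nat.card {β : Idx ν 1 → R //
        bilin ν d α.1 β = 1 ∧ bilin ν d β β = 0 ∧ IsUnit (bilin ν d α'.1 β)} := by
  rw [← Nat.card_coe_set_eq]
  have hunit : ∀ β : Idx ν 1 → R, bilin ν d α.1 β = 1 → ∃ i, IsUnit (β i) := by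
    intro β h
    rw [bilin_apply] at h
    exact exists_isUnit_of_isUnit_form (h ▸ isUnit_one)
  have hmem : ∀ β : {β : Idx ν 1 → R //
      bilin ν d α.1 β = 1 ∧ bilin ν d β β = 0 ∧ IsUnit (bilin ν d α'.1 β)},
      Vertex.mk ⟨β.1, hunit _ β.2.1⟩ β.2.2.1 ∈ (graph ν ![d]).commonNeighbors v w := by
    intro β
    rw [SimpleGraph.mem_commonNeighbors, graph_adj_iff v _ hα rfl, graph_adj_iff w _ hα' rfl,
      ← bilin_apply, ← bilin_apply]
    exact ⟨by rw [β.2.1]; exact isUnit_one, β.2.2.2⟩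
  refine (Nat.card_congr (Equiv.ofBijective
    (fun β => ⟨Vertex.mk ⟨β.1, hunit _ β.2.1⟩ β.2.2.1, hmem β⟩) ⟨?_, ?_⟩)).symm
  · rintro ⟨β, h1, h2, h3⟩ ⟨β', h1', h2', h3'⟩ h
    have h := congrArg (fun x => x.1.1) h
    obtain ⟨u, hu⟩ := Point.mk_eq_iff.1 h
    dsimp only at hu
    rw [hu, map_smul, h1', smul_eq_mul, mul_one] at h1
    rw [h1, one_smul] at hu
    exact Subtype.ext hu
  · rintro ⟨x, hx⟩
    obtain ⟨γ, hγ, hγ0⟩ := x.exists_rep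
    rw [SimpleGraph.mem_commonNeighbors, graph_adj_iff v x hα hγ, graph_adj_iff w x hα' hγ,
      ← bilin_apply, ← bilin_apply] at hx
    obtain ⟨⟨u, hu⟩, h2⟩ := hx
    refine ⟨⟨((u⁻¹ : Rˣ) : R) • γ.1, ?_, ?_, ?_⟩, ?_⟩
    · rw [map_smul, ← hu, smul_eq_mul, Units.inv_mul]
    · simp [hγ0]
    · rw [map_smul]
      exact (u⁻¹).isUnit.mul h2
    · apply Subtype.ext
      apply Subtype.ext
      rw [← hγ]
      exact Point.mk_eq_iff.2 ⟨u⁻¹, rfl⟩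

/-- The number of common neighbours of `[α]` and `[α']` is determined by a count over the residue
field, namely that of the residues of the vectors in `card_units_mul_card_mul_card_isotropic`. -/
theorem card_units_mul_ncard_commonNeighbors (h2 : IsUnit (2 : R)) {d : R}
    (v w : Vertex ν ![d]) {α α' : UnitTuple R (Idx ν 1)}
    (hα : Point.mk α = v.1) (hα' : Point.mk α' = w.1) :
    Nat.card Rˣ * Nat.card R * ((graph ν ![d]).commonNeighbors v w).ncard *
        Nat.card (ResidueField R) ^ (2 * ν + 1) =
      Nat.card R ^ (2 * ν + 1) * Nat.card {β : Idx ν 1 → ResidueField R //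
        bilin ν (residue R d) (fun i => residue R (α.1 i)) β ≠ 0 ∧
        2 * bilin ν (residue R d) (fun i => residue R (α.1 i)) β *
            bilin ν (residue R d) (fun i => residue R (α'.1 i)) β -
          bilin ν (residue R d) (fun i => residue R (α'.1 i)) (fun i => residue R (α.1 i)) *
            bilin ν (residue R d) β β ≠ 0} := by
  have hn := card_idx ν
  have h0 : bilin ν d α.1 α.1 = 0 := by
    rw [bilin_apply]
    exact form_self_of_mk_eq v hα
  rw [ncard_commonNeighbors v w hα hα',
    card_units_mul_card_mul_card_isotropic (bilin ν d) (bilin_comm d) h2 α.1 α'.1 h0, ← hn,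
    ← card_residue_preimage]
  congr 1
  refine Nat.card_congr (Equiv.subtypeEquivRight fun β => ?_)
  rw [bilin_map, bilin_map, bilin_map, bilin_map, ← map_ofNat (residue R) 2, ← map_mul, ← map_mul,
    ← map_mul, ← map_sub, residue_ne_zero_iff_isUnit, residue_ne_zero_iff_isUnit]

variable [Finite R]

/-- Points with proportional residues have the same neighbours, so they have as many common
neighbours as neighbours; for `v = w` this is the valency. -/
theorem ncard_commonNeighbors_of_proportional (h2 : IsUnit (2 : R)) {d : R} (hd : IsUnit d)
    (v w : Vertex ν ![d]) {α α' : UnitTuple R (Idx ν 1)}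
    (hα : Point.mk α = v.1) (hα' : Point.mk α' = w.1)
    (h : ∃ c : ResidueField R, (fun i => residue R (α'.1 i)) = c • fun i => residue R (α.1 i)) :
    ((graph ν ![d]).commonNeighbors v w).ncard * Nat.card R = Nat.card R ^ (2 * ν) := by
  have key := card_units_mul_ncard_commonNeighbors h2 v w hα hα'
  have hU := card_units_mul_card_residueField (R := R)
  have hα0 := (exists_isUnit_iff α.1).1 α.2
  have hα'0 := (exists_isUnit_iff α'.1).1 α'.2
  have hnd := exists_bilin_ne_zero (ν := ν) ((residue_ne_zero_iff_isUnit d).2 hd)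
  have hC := card_mul_card_ne_zero _ hα0 hnd
  have h20 := residueField_two_ne_zero h2
  have h00 : bilin ν (residue R d) (fun i => residue R (α.1 i))
      (fun i => residue R (α.1 i)) = 0 := by
    have := form_self_of_mk_eq v hα
    rw [bilin_map, bilin_apply, this, map_zero]
  obtain ⟨c, hc⟩ := h
  have hc0 : c ≠ 0 := by
    rintro rfl
    rw [zero_smul] at hc
    exact hα'0 hc
  rw [hc] at key
  simp only [map_smul, LinearMap.smul_apply, smul_eq_mul, h00, mul_zero, zero_mul, sub_zero, ne_eq,
    mul_eq_zero, h20, hc0, false_or, not_or, and_self] at key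
  simp only [ne_eq] at hC
  rw [Nat.card_fun, Nat.card_eq_fintype_card (α := Idx ν 1),
    card_idx] at hC
  generalize Nat.card {β : Idx ν 1 → ResidueField R //
    ¬ bilin ν (residue R d) (fun i => residue R (α.1 i)) β = 0} = C at *
  have hq : 1 < Nat.card (ResidueField R) := Finite.one_lt_card
  have hR : 0 < Nat.card R := Nat.card_pos
  generalize ((graph ν ![d]).commonNeighbors v w).ncard = X at *
  generalize Nat.card (ResidueField R) = q at *
  generalize Nat.card R = r at *
  generalize Nat.card Rˣ = U at *
  have hpos : 0 < r * (q - 1) * q ^ (2 * ν + 1) :=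
    Nat.mul_pos (Nat.mul_pos hR (by omega)) (pow_pos (by omega) _)
  refine Nat.eq_of_mul_eq_mul_right hpos ?_
  calc X * r * (r * (q - 1) * q ^ (2 * ν + 1))
      = (U * r * X * q ^ (2 * ν + 1)) * q := by rw [← hU]; ring
    _ = r ^ (2 * ν + 1) * (C * q) := by rw [key]; ring
    _ = _ := by rw [hC]; ring

/-- Points with independent residues, whether or not these are orthogonal. -/
theorem ncard_commonNeighbors_of_independent (h2 : IsUnit (2 : R)) {d : R} (hd : IsUnit d)
    (v w : Vertex ν ![d]) {α α' : UnitTuple R (Idx ν 1)}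
    (hα : Point.mk α = v.1) (hα' : Point.mk α' = w.1)
    (h : ∀ c : ResidueField R, (fun i => residue R (α'.1 i)) ≠ c • fun i => residue R (α.1 i)) :
    ((graph ν ![d]).commonNeighbors v w).ncard * Nat.card (ResidueField R) * Nat.card R =
      Nat.card R ^ (2 * ν) * (Nat.card (ResidueField R) - 1) := by
  have key := card_units_mul_ncard_commonNeighbors h2 v w hα hα'
  have hU := card_units_mul_card_residueField (R := R)
  have hd' := (residue_ne_zero_iff_isUnit d).2 hd
  have h20 := residueField_two_ne_zero h2
  have hC := card_of_independent_mul _ (bilin_comm (ν := ν) (residue R d))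
    (exists_bilin_ne_zero hd') h20 (card_isotropic_mul h20 hd')
    ((exists_isUnit_iff α.1).1 α.2) h
    (by rw [bilin_map, bilin_apply, form_self_of_mk_eq v hα, map_zero])
    (by rw [bilin_map, bilin_apply, form_self_of_mk_eq w hα', map_zero])
  rw [Nat.card_fun, Nat.card_eq_fintype_card (α := Idx ν 1),
    card_idx] at hC
  generalize Nat.card {β : Idx ν 1 → ResidueField R // _} = C at *
  have hq : 1 < Nat.card (ResidueField R) := Finite.one_lt_card
  have hR : 0 < Nat.card R := Nat.card_pos
  generalize ((graph ν ![d]).commonNeighbors v w).ncard = X at *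
  generalize Nat.card (ResidueField R) = q at *
  generalize Nat.card R = r at *
  generalize Nat.card Rˣ = U at *
  have hpos : 0 < r * (q - 1) * q ^ (2 * ν + 1) :=
    Nat.mul_pos (Nat.mul_pos hR (by omega)) (pow_pos (by omega) _)
  refine Nat.eq_of_mul_eq_mul_right hpos ?_
  calc X * q * r * (r * (q - 1) * q ^ (2 * ν + 1))
      = (U * r * X * q ^ (2 * ν + 1)) * q ^ 2 := by rw [← hU]; ring
    _ = r ^ (2 * ν + 1) * (C * q ^ 2) := by rw [key]; ring
    _ = _ := by rw [hC]; ring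

theorem card_vertex_mul (h2 : IsUnit (2 : R)) {d : R} (hd : IsUnit d) :
    Nat.card (Vertex ν ![d]) * (Nat.card (ResidueField R) - 1) * Nat.card (maximalIdeal R) =
      Nat.card (maximalIdeal R) ^ (2 * ν) * (Nat.card (ResidueField R) ^ (2 * ν) - 1) := by
  have h1 := card_isotropic_unitTuple_mul (ν := ν) h2 hd
  rw [← card_units_mul_card_vertex] at h1
  have hU := card_units_mul_card_residueField (R := R)
  rw [← card_maximalIdeal_mul_card_residueField (R := R)] at hU
  have hq : 0 < Nat.card (ResidueField R) := Nat.card_pos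
  have hM : 0 < Nat.card (maximalIdeal R) := Nat.card_pos
  generalize Nat.card (Vertex ν ![d]) = N at *
  generalize Nat.card (ResidueField R) = q at *
  generalize Nat.card (maximalIdeal R) = M at *
  generalize Nat.card Rˣ = U at *
  have hU : U = M * (q - 1) := Nat.eq_of_mul_eq_mul_right hq (by rw [hU]; ring)
  subst hU
  refine Nat.eq_of_mul_eq_mul_left hM ?_
  rw [pow_succ] at h1
  linear_combination h1

/-- If the maximal ideal contains `ϖ ≠ 0`, non-adjacency occurs in two ways: `[e₁]` and
`[e₁ + ϖ e₂]` have the same residue, while `[e₁]` and `[e₂]` have independent orthogonal residues.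
This is what prevents strong regularity. -/
theorem exists_not_adj (h2 : IsUnit (2 : R)) {d : R} (hd : IsUnit d) (hν : 2 ≤ ν) {ϖ : R}
    (hϖ : ϖ ≠ 0) (hm : ϖ ∈ maximalIdeal R) :
    ∃ v w w' : Vertex ν ![d], v ≠ w ∧ ¬ (graph ν ![d]).Adj v w ∧
      v ≠ w' ∧ ¬ (graph ν ![d]).Adj v w' ∧
      ((graph ν ![d]).commonNeighbors v w).ncard * Nat.card R = Nat.card R ^ (2 * ν) ∧
      ((graph ν ![d]).commonNeighbors v w').ncard * Nat.card (ResidueField R) * Nat.card R =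
        Nat.card R ^ (2 * ν) * (Nat.card (ResidueField R) - 1) := by
  obtain ⟨μ, rfl⟩ := Nat.exists_eq_add_of_le' hν
  let T : (Fin (μ + 2) → R) → Idx (μ + 2) 1 → R := fun x => Sum.elim (Sum.elim x 0) 0
  have hT : ∀ x y, bilin (μ + 2) d (T x) (T y) = 0 := by
    intro x y
    rw [bilin_apply, form_eq]
    simp [T]
  let a : UnitTuple R (Idx (μ + 2) 1) := ⟨T (Pi.single 0 1), .inl (.inl 0), by simp [T]⟩
  let b : UnitTuple R (Idx (μ + 2) 1) :=
    ⟨T (Pi.single 0 1 + ϖ • Pi.single 1 1), .inl (.inl 0), by simp [T]⟩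
  let c : UnitTuple R (Idx (μ + 2) 1) := ⟨T (Pi.single 1 1), .inl (.inl 1), by simp [T]⟩
  have hadj : ∀ (x y : UnitTuple R (Idx (μ + 2) 1)) (hx : bilin (μ + 2) d x.1 x.1 = 0)
      (hy : bilin (μ + 2) d y.1 y.1 = 0), bilin (μ + 2) d x.1 y.1 = 0 →
      ¬ (graph (μ + 2) ![d]).Adj (Vertex.mk x hx) (Vertex.mk y hy) := by
    intro x y hx hy h
    rw [graph_adj_iff _ _ (α := x) (β := y) rfl rfl, ← bilin_apply, h]
    exact not_isUnit_zero
  refine ⟨Vertex.mk a (hT _ _), Vertex.mk b (hT _ _), Vertex.mk c (hT _ _), ?_,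
    hadj _ _ _ _ (hT _ _), ?_, hadj _ _ _ _ (hT _ _),
    ncard_commonNeighbors_of_proportional h2 hd _ _ (α := a) (α' := b) rfl rfl ⟨1, ?_⟩,
    ncard_commonNeighbors_of_independent h2 hd _ _ (α := a) (α' := c) rfl rfl fun x hx => ?_⟩
  · intro h
    obtain ⟨u, hu⟩ := Point.mk_eq_iff.1 (congrArg Subtype.val h)
    have := congrFun hu (.inl (.inl 1))
    simp only [a, b, T, Pi.smul_apply, Sum.elim_inl, Pi.add_apply] at this
    simp [eq_comm (a := (0 : R)), hϖ] at this
  · intro h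
    obtain ⟨u, hu⟩ := Point.mk_eq_iff.1 (congrArg Subtype.val h)
    have := congrFun hu (.inl (.inl 0))
    simp [a, c, T] at this
  · rw [one_smul]
    funext i
    obtain (i | i) | i := i
    · simp [a, b, T, (residue_eq_zero_iff ϖ).2 hm]
    · simp [a, b, T]
    · simp [a, b, T]
  · have := congrFun hx (.inl (.inl 1))
    simp [a, c, T] at this

theorem ncard_commonNeighbors_eq_or (h2 : IsUnit (2 : R)) {d : R} (hd : IsUnit d)
    (v w : Vertex ν ![d]) :
    ((graph ν ![d]).commonNeighbors v w).ncard * Nat.card R = Nat.card R ^ (2 * ν) ∨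
      ((graph ν ![d]).commonNeighbors v w).ncard * Nat.card (ResidueField R) * Nat.card R =
        Nat.card R ^ (2 * ν) * (Nat.card (ResidueField R) - 1) := by
  obtain ⟨α, hα, -⟩ := v.exists_rep
  obtain ⟨α', hα', -⟩ := w.exists_rep
  by_cases h : ∃ c : ResidueField R,
      (fun i => residue R (α'.1 i)) = c • fun i => residue R (α.1 i)
  · exact .inl (ncard_commonNeighbors_of_proportional h2 hd v w hα hα' h)
  · push Not at h
    exact .inr (ncard_commonNeighbors_of_independent h2 hd v w hα hα' h)

theorem ncard_neighborSet_mul (h2 : IsUnit (2 : R)) {d : R} (hd : IsUnit d) (v : Vertex ν ![d]) :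
    ((graph ν ![d]).neighborSet v).ncard * Nat.card R = Nat.card R ^ (2 * ν) := by
  obtain ⟨α, hα, -⟩ := v.exists_rep
  have := ncard_commonNeighbors_of_proportional h2 hd v v hα hα ⟨1, (one_smul _ _).symm⟩
  rwa [SimpleGraph.commonNeighbors, Set.inter_self] at this

end Graph

end Orthogonal

/-! ### Deza graphs -/

/-- Two distinct non-adjacent vertices and common neighbours everywhere force diameter `2`. -/
theorem SimpleGraph.ediam_eq_two {V : Type*} (G : SimpleGraph V) {v w : V} (hne : v ≠ w)
    (hadj : ¬ G.Adj v w) (h : ∀ x y, x ≠ y → (G.commonNeighbors x y).Nonempty) :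
    G.ediam = 2 := by
  apply le_antisymm
  · refine SimpleGraph.ediam_le_of_edist_le fun x y => ?_
    by_cases hxy : x = y
    · subst hxy
      simp
    · obtain ⟨z, hz⟩ := h x y hxy
      rw [SimpleGraph.mem_commonNeighbors] at hz
      exact (SimpleGraph.Walk.cons hz.1 (SimpleGraph.Walk.cons hz.2.symm .nil)).edist_le
  · refine le_trans ?_ (SimpleGraph.edist_le_ediam (u := v) (v := w))
    by_contra hlt
    have h1 : G.edist v w ≤ 1 := Order.le_of_lt_add_one (by simpa [one_add_one_eq_two] using hlt)
    obtain h1 | h1 := h1.lt_or_eq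
    · rw [Order.lt_one_iff, SimpleGraph.edist_eq_zero_iff] at h1
      exact hne h1
    · exact hadj (SimpleGraph.edist_eq_one_iff_adj.1 h1)

/-- In a strongly regular graph distinct non-adjacent vertices all have equally many common
neighbours. -/
theorem IsStronglyRegular.ncard_commonNeighbors_eq {V : Type*} {G : SimpleGraph V}
    (h : IsStronglyRegular G) {v w w' : V} (hw : v ≠ w) (hvw : ¬ G.Adj v w) (hw' : v ≠ w')
    (hvw' : ¬ G.Adj v w') :
    (G.commonNeighbors v w).ncard = (G.commonNeighbors v w').ncard := by
  obtain ⟨_, _, _, n, k, l, μ, h⟩ := h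
  have h1 := h.of_not_adj hw hvw
  have h2 := h.of_not_adj hw' hvw'
  rw [← Nat.card_eq_fintype_card, Nat.card_coe_set_eq] at h1 h2
  rw [h1, h2]

-- All numerical identities are solved for the cardinality in question after multiplying by a power
-- of `q = p ^ m`; the truncated subtractions in the exponents are resolved by writing
-- `s = σ + 2` and `ν = μ + 2`.
theorem mainTheorem6 (p s m ν : ℕ) (hp : p.Prime) (hp2 : p ≠ 2) (hs : 2 ≤ s) (hm : 1 ≤ m)
    (hν : 2 ≤ ν) {R : Type*} [CommRing R] (hR : IsGaloisRing p s m R)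
    (z : R) (hz : IsUnit z) (hz' : ¬ IsSquare z) (d : R) (hd : d = 1 ∨ d = z) :
    IsStrictlyDezaGraph (Orthogonal.graph ν ![d])
      ((p ^ (2 * m * ν) - 1) * p ^ (m * (s - 1) * (2 * ν - 1)) / (p ^ m - 1))
      (p ^ (m * s * (2 * ν - 1)))
      ((p ^ m - 1) * p ^ (m * (2 * s * ν - s - 1)))
      (p ^ (m * s * (2 * ν - 1))) := by
  have := hR.finite
  have := hR.isLocalRing hs
  have := hR.charP
  have hdu : IsUnit d := by
    obtain rfl | rfl := hd
    · exact isUnit_one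
    · exact hz
  have h2 := hR.isUnit_two hp2
  have hp0 : (p : R) ≠ 0 := by
    intro h0
    have h1 : p ^ s ∣ p ^ 1 := (CharP.cast_eq_zero_iff R (p ^ s) (p ^ 1)).1 (by simpa using h0)
    have := (Nat.pow_dvd_pow_iff_le_right hp.one_lt).1 h1
    omega
  have hpm : (p : R) ∈ IsLocalRing.maximalIdeal R := by
    rw [hR.maximalIdeal_eq]
    exact Ideal.mem_span_singleton_self _
  have hF : Nat.card (IsLocalRing.ResidueField R) = p ^ m := hR.card_residueField hs
  have hcR : Nat.card R = (p ^ m) ^ s := by rw [hR.card_eq_card_residueField_pow, hF]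
  have hM := card_maximalIdeal_mul_card_residueField (R := R)
  have hV := Orthogonal.card_vertex_mul (ν := ν) h2 hdu
  have hnb := Orthogonal.ncard_neighborSet_mul (ν := ν) h2 hdu
  have hcn := Orthogonal.ncard_commonNeighbors_eq_or (ν := ν) h2 hdu
  obtain ⟨v, w, w', hvw, hadj, hvw', hadj', hcw, hcw'⟩ :=
    Orthogonal.exists_not_adj h2 hdu hν hp0 hpm
  have hq : 1 < p ^ m := Nat.one_lt_pow (by omega) hp.one_lt
  rw [hF, hcR] at *
  rw [pow_mul p (2 * m) ν, mul_comm 2 m, pow_mul p m 2, mul_assoc m (s - 1), pow_mul p m,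
    mul_assoc m s, pow_mul p m (s * _), pow_mul p m (2 * s * ν - s - 1), ← pow_mul _ 2 ν]
  generalize p ^ m = q at *
  have hq0 : 0 < q := by omega
  obtain ⟨σ, rfl⟩ := Nat.exists_eq_add_of_le' hs
  obtain ⟨μ, rfl⟩ := Nat.exists_eq_add_of_le' hν
  have hk : ∀ X : ℕ, X * q ^ (σ + 2) = (q ^ (σ + 2)) ^ (2 * (μ + 2)) →
      X = q ^ ((σ + 2) * (2 * (μ + 2) - 1)) := by
    intro X hX
    refine Nat.eq_of_mul_eq_mul_right (pow_pos hq0 (σ + 2)) ?_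
    rw [hX, ← pow_mul, ← pow_add, show 2 * (μ + 2) - 1 = 2 * μ + 3 by omega]
    ring
  have hb : ∀ X : ℕ, X * q * q ^ (σ + 2) = (q ^ (σ + 2)) ^ (2 * (μ + 2)) * (q - 1) →
      X = (q - 1) * q ^ (2 * (σ + 2) * (μ + 2) - (σ + 2) - 1) := by
    intro X hX
    refine Nat.eq_of_mul_eq_mul_right (pow_pos hq0 (σ + 3)) ?_
    have he : 2 * (σ + 2) * (μ + 2) - (σ + 2) - 1 + (σ + 3) = (σ + 2) * (2 * (μ + 2)) := by
      have : (σ + 2) * (2 * (μ + 2)) = 2 * (σ + 2) * (μ + 2) := by ring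
      have : 2 * (σ + 2) * (μ + 2) = (σ + 3) + (2 * σ * μ + 4 * μ + 3 * σ + 5) := by ring
      omega
    calc X * q ^ (σ + 3) = X * q * q ^ (σ + 2) := by ring
      _ = _ := by rw [hX, ← pow_mul, mul_assoc, ← pow_add, he, mul_comm]
  refine ⟨⟨Orthogonal.finite_vertex d, ?_, fun v => hk _ (hnb v), fun v w _ => ?_⟩, ?_, ?_⟩
  · have hM : Nat.card (IsLocalRing.maximalIdeal R) = q ^ (σ + 1) :=
      Nat.eq_of_mul_eq_mul_right hq0 (by rw [hM]; ring)
    rw [hM] at hV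
    symm
    refine Nat.div_eq_of_eq_mul_left (by omega) ?_
    refine Nat.eq_of_mul_eq_mul_right (pow_pos hq0 (σ + 1)) ?_
    rw [hV, ← pow_mul, mul_assoc, ← pow_add, mul_comm]
    have he : (σ + 1) * (2 * (μ + 2)) =
        (σ + 2 - 1) * (2 * (μ + 2) - 1) + (σ + 1) := by
      rw [show 2 * (μ + 2) - 1 = 2 * μ + 3 by omega, show σ + 2 - 1 = σ + 1 by omega]
      ring
    rw [he]
  · exact (hcn v w).symm.imp (hb _) (hk _)
  · refine SimpleGraph.ediam_eq_two _ hvw hadj fun x y _ => ?_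
    apply Set.nonempty_of_ncard_ne_zero
    obtain h | h := hcn x y
    · rw [hk _ h]
      positivity
    · rw [hb _ h]
      exact Nat.mul_ne_zero (by omega) (pow_pos hq0 _).ne'
  · intro h
    rw [h.ncard_commonNeighbors_eq hvw hadj hvw' hadj'] at hcw
    have h1 : (q ^ (σ + 2)) ^ (2 * (μ + 2)) * q = (q ^ (σ + 2)) ^ (2 * (μ + 2)) * (q - 1) := by
      rw [← hcw', ← hcw]
      ring
    have := Nat.eq_of_mul_eq_mul_left (by positivity) h1
    omega
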